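/- Let $M$ be a bounded, connected, embedded complex submanifold of $\mathbb{C}^d$, let $\mathsf{k}_M$ be its Kobayashi distance and $\kappa_M$ its Kobayashi--Royden metric, and put $\partial M=\overline{M}\setminus M$. A real Kobayashi geodesic in $M$ is a map $\sigma:I\to M$ on an interval $I\subset\mathbb{R}$ with $\mathsf{k}_M(\sigma(s),\sigma(t))=|s-t|$ for all $s,t\in I$. For $\lambda\ge 1$ and $\kappa\ge 0$, a $(\lambda,\kappa)$-almost-geodesic in $M$ is an absolutely continuous curve $\sigma:I\to M$ such that $\frac1\lambda|t-s|-\kappa\le \mathsf{k}_M(\sigma(t),\sigma(s))\le\lambda|t-s|+\kappa$ for all $s,t\in I$ and $\kappa_M(\sigma(t),\sigma'(t))\le\lambda$ for almost every $t\in I$. A class $\mathcal{C}$ of curves in $M$ is said to satisfy $(\ast)$ if for every pair of points $p\ne q$ in $\partial M$ there are $\mathbb{C}^d$-neighbourhoods $V$ of $p$ and $W$ of $q$ with $\overline V\cap\overline W=\emptyset$ and a compact set $K\subset M$ such that every curve in $\mathcal{C}$ with initial point in $V$ and terminal point in $W$ intersects $K$. The submanifold $M$ is a BZ-visibility submanifold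 if, for every $\lambda\ge1$ and every $\kappa>0$, any two distinct points of $M$ can be joined by a $(\lambda,\kappa)$-almost-geodesic and the $(\lambda,\kappa)$-almost-geodesics in $M$ satisfy $(\ast)$. It is a BNT-visibility submanifold if $(M,\mathsf{k}_M)$ is complete and the real Kobayashi geodesics in $M$ satisfy $(\ast)$. Suppose that $(M,\mathsf{k}_M)$ is a complete Gromov hyperbolic distance space, i.e. it is complete and there is a $\delta$ such that each side of every geodesic triangle in $(M,\mathsf{k}_M)$ lies in the $\delta$-neighbourhood of the union of the other two sides. Then $M$ is a BZ-visibility submanifold if and only if it is a BNT-visibility submanifold. -/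

import Mathlib

open Set Filter Topology MeasureTheory
open scoped ENNReal

/-- The Hermitian space `ℂ^d`, with its Euclidean norm. -/
abbrev CSpace (d : ℕ) : Type := EuclideanSpace ℂ (Fin d)

/-- `M ⊆ ℂ^d` is an embedded complex submanifold: around each of its points there is a biholomorphic
map `Φ` between open subsets of `ℂ^d` that straightens `M` to a complex linear subspace. -/
def IsEmbeddedComplexSubmanifold {d : ℕ} (M : Set (CSpace d)) : Prop :=
  ∀ p ∈ M, ∃ (Φ : OpenPartialHomeomorph (CSpace d) (CSpace d)) (L : Submodule ℂ (CSpace d)),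
    p ∈ Φ.source ∧ DifferentiableOn ℂ Φ Φ.source ∧ DifferentiableOn ℂ Φ.symm Φ.target ∧
      ∀ z ∈ Φ.source, z ∈ M ↔ Φ z ∈ L

/-- The boundary `∂M = closure M \ M` of a submanifold `M` of `ℂ^d`. -/
def submanifoldBoundary {d : ℕ} (M : Set (CSpace d)) : Set (CSpace d) :=
  closure M \ M

/-- `f` restricts to a holomorphic map from the open unit disc into `M`. -/
def IsHolomorphicDisc {d : ℕ} (M : Set (CSpace d)) (f : ℂ → CSpace d) : Prop :=
  DifferentiableOn ℂ f (Metric.ball 0 1) ∧ MapsTo f (Metric.ball 0 1) M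

/-- The Poincaré distance of the open unit disc, normalised as the integrated form of
`|dζ| / (1 - |ζ|²)`. -/
noncomputable def poincareDist (a b : ℂ) : ℝ :=
  Real.artanh (‖a - b‖ / ‖1 - (starRingEnd ℂ) b * a‖)

/-- `c` is the length of a chain of holomorphic discs in `M` from `z` to `w`: there are points
`z = p 0, p 1, …, p n = w` such that `p j` and `p (j + 1)` are the images of points `a j` and `b j`
of the unit disc under a holomorphic disc `f j` in `M`, and `c` is the sum of the Poincaré
distances between `a j` and `b j`. -/
def IsDiscChainLength {d : ℕ} (M : Set (CSpace d)) (z w : CSpace d) (c : ℝ) : Prop :=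
  ∃ (n : ℕ) (p : ℕ → CSpace d) (f : ℕ → ℂ → CSpace d) (a b : ℕ → ℂ),
    p 0 = z ∧ p n = w ∧
    (∀ j < n, IsHolomorphicDisc M (f j) ∧ a j ∈ Metric.ball (0 : ℂ) 1 ∧
      b j ∈ Metric.ball (0 : ℂ) 1 ∧ f j (a j) = p j ∧ f j (b j) = p (j + 1)) ∧
    c = ∑ j ∈ Finset.range n, poincareDist (a j) (b j)

/-- The Kobayashi distance `k_M(z, w)` of points of `M`: the infimum of the lengths of chains of
holomorphic discs from `z` to `w`. -/
noncomputable def kobayashiDist {d : ℕ} (M : Set (CSpace d)) (z w : CSpace d) : ℝ :=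
  sInf {c : ℝ | IsDiscChainLength M z w c}

/-- The Kobayashi–Royden metric `κ_M(z; X)` at a point `z` of `M`: the infimum of `|α|` over all
`α ∈ ℂ` and all holomorphic discs `f` in `M` with `f 0 = z` and `α f'(0) = X`. It is finite on
vectors tangent to `M`, and `∞` on the others. -/
noncomputable def kobayashiRoyden {d : ℕ} (M : Set (CSpace d)) (z X : CSpace d) : ℝ≥0∞ :=
  sInf {c : ℝ≥0∞ | ∃ (f : ℂ → CSpace d) (α : ℂ),
    IsHolomorphicDisc M f ∧ f 0 = z ∧ α • deriv f 0 = X ∧ c = ENNReal.ofReal ‖α‖}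

/-- The restriction of `σ` to the compact interval `[a, b]` is a real Kobayashi geodesic in `M`,
that is, an isometry from `[a, b]` to `(M, k_M)`. -/
def IsKobayashiGeodesic {d : ℕ} (M : Set (CSpace d)) (σ : ℝ → CSpace d) (a b : ℝ) : Prop :=
  a ≤ b ∧ MapsTo σ (Icc a b) M ∧
    ∀ s ∈ Icc a b, ∀ t ∈ Icc a b, kobayashiDist M (σ s) (σ t) = |s - t|

/-- The restriction of `σ` to the compact interval `[a, b]` is a `(lam, kap)`-almost-geodesic
in `M`. -/
def IsAlmostGeodesic {d : ℕ} (M : Set (CSpace d)) (lam kap : ℝ) (σ : ℝ → CSpace d)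
    (a b : ℝ) : Prop :=
  a ≤ b ∧ MapsTo σ (Icc a b) M ∧
    (∀ s ∈ Icc a b, ∀ t ∈ Icc a b,
      1 / lam * |t - s| - kap ≤ kobayashiDist M (σ t) (σ s) ∧
        kobayashiDist M (σ t) (σ s) ≤ lam * |t - s| + kap) ∧
    AbsolutelyContinuousOnInterval σ a b ∧
    ∀ᵐ t ∂(volume.restrict (Icc a b)),
      DifferentiableAt ℝ σ t ∧ kobayashiRoyden M (σ t) (deriv σ t) ≤ ENNReal.ofReal lam

/-- The visibility condition for a class `C` of curves in `M`, where `C σ a b` says that the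
restriction of `σ` to `[a, b]` belongs to the class: any two distinct boundary points have
neighbourhoods `V`, `W` in `ℂ^d` with disjoint closures and a compact set `K ⊆ M` that is met by
all curves of the class with initial point in `V` and terminal point in `W`. -/
def HasVisibility {d : ℕ} (M : Set (CSpace d)) (C : (ℝ → CSpace d) → ℝ → ℝ → Prop) : Prop :=
  ∀ p ∈ submanifoldBoundary M, ∀ q ∈ submanifoldBoundary M, p ≠ q →
    ∃ V ∈ 𝓝 p, ∃ W ∈ 𝓝 q, ∃ K : Set (CSpace d),
      closure V ∩ closure W = ∅ ∧ K ⊆ M ∧ IsCompact K ∧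
        ∀ (σ : ℝ → CSpace d) (a b : ℝ), C σ a b → σ a ∈ V → σ b ∈ W → ∃ t ∈ Icc a b, σ t ∈ K

/-- `M` is a `(lam, kap)`-visibility submanifold. -/
def IsAlmostGeodesicVisibility {d : ℕ} (M : Set (CSpace d)) (lam kap : ℝ) : Prop :=
  (∀ x ∈ M, ∀ y ∈ M, x ≠ y →
    ∃ (σ : ℝ → CSpace d) (a b : ℝ), IsAlmostGeodesic M lam kap σ a b ∧ σ a = x ∧ σ b = y) ∧
  HasVisibility M (IsAlmostGeodesic M lam kap)

/-- `M` is a BZ-visibility submanifold. -/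
def IsBZVisibility {d : ℕ} (M : Set (CSpace d)) : Prop :=
  ∀ lam kap : ℝ, 1 ≤ lam → 0 < kap → IsAlmostGeodesicVisibility M lam kap

/-- `(M, k_M)` is complete: every `k_M`-Cauchy sequence in `M` converges, with respect to `k_M`, to
a point of `M`. -/
def IsKobayashiComplete {d : ℕ} (M : Set (CSpace d)) : Prop :=
  ∀ u : ℕ → CSpace d, (∀ n, u n ∈ M) →
    (∀ ε > 0, ∃ N, ∀ m ≥ N, ∀ n ≥ N, kobayashiDist M (u m) (u n) < ε) →
    ∃ x ∈ M, Tendsto (fun n => kobayashiDist M (u n) x) atTop (𝓝 0)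

/-- `M` is a BNT-visibility submanifold. -/
def IsBNTVisibility {d : ℕ} (M : Set (CSpace d)) : Prop :=
  IsKobayashiComplete M ∧ HasVisibility M (IsKobayashiGeodesic M)

/-- `(M, k_M)` (a geodesic space whenever it is complete) is Gromov hyperbolic: for some `δ`, every
side of every geodesic triangle lies in the `δ`-neighbourhood of the union of the other two sides.
The sides run cyclically from `x` to `y`, from `y` to `z` and from `z` to `x`, so that it
suffices to say this of the first one. -/
def IsKobayashiGromovHyperbolic {d : ℕ} (M : Set (CSpace d)) : Prop :=
  ∃ δ : ℝ, ∀ (σ₁ σ₂ σ₃ : ℝ → CSpace d) (a₁ b₁ a₂ b₂ a₃ b₃ : ℝ),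
    IsKobayashiGeodesic M σ₁ a₁ b₁ → IsKobayashiGeodesic M σ₂ a₂ b₂ →
    IsKobayashiGeodesic M σ₃ a₃ b₃ →
    σ₁ b₁ = σ₂ a₂ → σ₂ b₂ = σ₃ a₃ → σ₃ b₃ = σ₁ a₁ →
    ∀ t ∈ Icc a₁ b₁,
      (∃ s ∈ Icc a₂ b₂, kobayashiDist M (σ₁ t) (σ₂ s) ≤ δ) ∨
        ∃ s ∈ Icc a₃ b₃, kobayashiDist M (σ₁ t) (σ₃ s) ≤ δ

section MetricGeometry

variable {X : Type*} [MetricSpace X]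

/-- The restriction of `γ` to `[a, b]` is an isometry. -/
def IsMetricGeodesic (γ : ℝ → X) (a b : ℝ) : Prop :=
  a ≤ b ∧ ∀ s ∈ Icc a b, ∀ t ∈ Icc a b, dist (γ s) (γ t) = |s - t|

/-- `S` is the image of a geodesic from `x` to `y`. -/
def IsGeodesicSegment (x y : X) (S : Set X) : Prop :=
  ∃ (γ : ℝ → X) (a b : ℝ), IsMetricGeodesic γ a b ∧ γ a = x ∧ γ b = y ∧ γ '' Icc a b = S

/-- Every side of a geodesic triangle lies in the closed `δ`-neighbourhood of the other two. -/
def HasThinTriangles (X : Type*) [MetricSpace X] (δ : ℝ) : Prop :=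
  ∀ (x y z : X) (S T U : Set X), IsGeodesicSegment x y S → IsGeodesicSegment y z T →
    IsGeodesicSegment z x U → ∀ p ∈ S, ∃ q ∈ T ∪ U, dist p q ≤ δ

theorem IsMetricGeodesic.continuousOn {γ : ℝ → X} {a b : ℝ} (h : IsMetricGeodesic γ a b) :
    ContinuousOn γ (Icc a b) := by
  have : LipschitzOnWith 1 γ (Icc a b) := by
    refine LipschitzOnWith.of_dist_le_mul fun s hs t ht => ?_
    simp [h.2 s hs t ht, Real.dist_eq]
  exact this.continuousOn

theorem IsMetricGeodesic.mono {γ : ℝ → X} {a b c e : ℝ} (h : IsMetricGeodesic γ a b)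
    (hac : a ≤ c) (hce : c ≤ e) (heb : e ≤ b) : IsMetricGeodesic γ c e :=
  ⟨hce, fun s hs t ht => h.2 s ⟨hac.trans hs.1, hs.2.trans heb⟩ t ⟨hac.trans ht.1, ht.2.trans heb⟩⟩

theorem IsGeodesicSegment.symm {x y : X} {S : Set X} (h : IsGeodesicSegment x y S) :
    IsGeodesicSegment y x S := by
  obtain ⟨γ, a, b, ⟨hab, hγ⟩, rfl, rfl, rfl⟩ := h
  refine ⟨fun t => γ (-t), -b, -a, ⟨by linarith, fun s hs t ht => ?_⟩, by simp, by simp, ?_⟩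
  · rw [hγ (-s) ⟨by linarith [hs.2], by linarith [hs.1]⟩ (-t) ⟨by linarith [ht.2], by linarith [ht.1]⟩,
      abs_sub_comm]
    congr 1; ring
  · ext p
    constructor
    · rintro ⟨t, ht, rfl⟩
      exact ⟨-t, ⟨by linarith [ht.2], by linarith [ht.1]⟩, rfl⟩
    · rintro ⟨t, ht, rfl⟩
      exact ⟨-t, ⟨by linarith [ht.2], by linarith [ht.1]⟩, by simp⟩

theorem IsGeodesicSegment.left_mem {x y : X} {S : Set X} (h : IsGeodesicSegment x y S) : x ∈ S := by
  obtain ⟨γ, a, b, ⟨hab, hγ⟩, rfl, rfl, rfl⟩ := h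
  exact mem_image_of_mem _ (left_mem_Icc.2 hab)

theorem IsGeodesicSegment.right_mem {x y : X} {S : Set X} (h : IsGeodesicSegment x y S) : y ∈ S :=
  h.symm.left_mem

theorem IsGeodesicSegment.dist_add_dist {x y p : X} {S : Set X} (h : IsGeodesicSegment x y S)
    (hp : p ∈ S) : dist x p + dist p y = dist x y := by
  obtain ⟨γ, a, b, ⟨hab, hγ⟩, rfl, rfl, rfl⟩ := h
  obtain ⟨t, ht, rfl⟩ := hp
  rw [hγ a (left_mem_Icc.2 hab) t ht, hγ t ht b (right_mem_Icc.2 hab),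
    hγ a (left_mem_Icc.2 hab) b (right_mem_Icc.2 hab), abs_of_nonpos (by linarith [ht.1]),
    abs_of_nonpos (by linarith [ht.2]), abs_of_nonpos (by linarith)]
  ring

theorem IsGeodesicSegment.isCompact {x y : X} {S : Set X} (h : IsGeodesicSegment x y S) :
    IsCompact S := by
  obtain ⟨γ, a, b, hγ, rfl, rfl, rfl⟩ := h
  exact isCompact_Icc.image_of_continuousOn hγ.continuousOn

theorem IsGeodesicSegment.isPreconnected {x y : X} {S : Set X} (h : IsGeodesicSegment x y S) :
    IsPreconnected S := by
  obtain ⟨γ, a, b, hγ, rfl, rfl, rfl⟩ := h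
  exact isPreconnected_Icc.image _ hγ.continuousOn

/-- The part of a geodesic segment within distance `r` of one of its points. -/
theorem IsGeodesicSegment.exists_subsegment {x y p : X} {S : Set X} (h : IsGeodesicSegment x y S)
    (hp : p ∈ S) {r : ℝ} (hr : 0 ≤ r) :
    ∃ u ∈ S, ∃ v ∈ S, ∃ T, IsGeodesicSegment u v T ∧ p ∈ T ∧ dist p u ≤ r ∧ dist p v ≤ r ∧
      (u = x ∨ dist p u = r) ∧ (v = y ∨ dist p v = r) := by
  obtain ⟨γ, a, b, hγ, rfl, rfl, rfl⟩ := h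
  obtain ⟨t, ht, rfl⟩ := hp
  have h1 : max a (t - r) ∈ Icc a b := ⟨le_max_left _ _, max_le hγ.1 (by linarith [ht.2])⟩
  have h2 : min b (t + r) ∈ Icc a b := ⟨le_min hγ.1 (by linarith [ht.1]), min_le_left _ _⟩
  have h1t : max a (t - r) ≤ t := max_le ht.1 (by linarith)
  have h2t : t ≤ min b (t + r) := le_min ht.2 (by linarith)
  refine ⟨_, mem_image_of_mem γ h1, _, mem_image_of_mem γ h2, _,
    ⟨γ, _, _, hγ.mono h1.1 (h1t.trans h2t) h2.2, rfl, rfl, rfl⟩,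
    mem_image_of_mem γ ⟨h1t, h2t⟩, ?_, ?_, ?_, ?_⟩
  · rw [hγ.2 _ ht _ h1, abs_of_nonneg (by linarith)]
    linarith [le_max_right a (t - r)]
  · rw [hγ.2 _ ht _ h2, abs_of_nonpos (by linarith)]
    linarith [min_le_right b (t + r)]
  · rcases le_total a (t - r) with h | h
    · right
      rw [hγ.2 _ ht _ h1, max_eq_right h, abs_of_nonneg (by linarith)]
      ring
    · left
      rw [max_eq_left h]
  · rcases le_total b (t + r) with h | h
    · left
      rw [min_eq_left h]
    · right
      rw [hγ.2 _ ht _ h2, min_eq_right h, abs_of_nonpos (by linarith)]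
      ring

/-- A point of a geodesic is at distance `O(log n)` from a polygon with `n` sides and the same
endpoints. -/
theorem HasThinTriangles.exists_near_polygon {δ : ℝ} (hX : HasThinTriangles X δ) (hδ : 0 ≤ δ)
    (hgeo : ∀ x y : X, ∃ S, IsGeodesicSegment x y S) (k : ℕ) :
    ∀ (n : ℕ) (w : ℕ → X) (S : Set X), 0 < n → n ≤ 2 ^ k → IsGeodesicSegment (w 0) (w n) S →
      ∀ p ∈ S, ∃ i < n, ∃ q, dist (w i) q + dist q (w (i + 1)) = dist (w i) (w (i + 1)) ∧
        dist p q ≤ k * δ := by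
  induction k with
  | zero =>
    intro n w S hn hn1 hS p hp
    obtain rfl : n = 1 := by simp at hn1; omega
    exact ⟨0, one_pos, p, hS.dist_add_dist hp, by simp⟩
  | succ k ih =>
    intro n w S hn hnk hS p hp
    by_cases hle : n ≤ 2 ^ k
    · obtain ⟨i, hi, q, hq, hpq⟩ := ih n w S hn hle hS p hp
      refine ⟨i, hi, q, hq, hpq.trans ?_⟩
      push_cast
      nlinarith
    · push Not at hle
      obtain ⟨T, hT⟩ := hgeo (w (2 ^ k)) (w n)
      obtain ⟨U, hU⟩ := hgeo (w 0) (w (2 ^ k))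
      obtain ⟨p', hp', hpp'⟩ := hX _ _ _ S T U hS hT.symm hU.symm p hp
      rcases hp' with hp' | hp'
      · obtain ⟨i, hi, q, hq, hpq⟩ := ih (n - 2 ^ k) (fun i => w (2 ^ k + i)) T (by omega)
          (by rw [pow_succ] at hnk; omega)
          (by simpa [Nat.add_sub_cancel' hle.le] using hT) p' hp'
        refine ⟨2 ^ k + i, by omega, q, hq, ?_⟩
        push_cast
        linarith [dist_triangle p p' q]
      · obtain ⟨i, hi, q, hq, hpq⟩ := ih (2 ^ k) w U (by positivity) le_rfl hU p' hp'
        refine ⟨i, by omega, q, hq, ?_⟩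
        push_cast
        linarith [dist_triangle p p' q]

theorem exists_bound_of_two_pow_le (A B C δ : ℝ) (hA : 0 ≤ A) (hδ : 0 ≤ δ) :
    ∃ R : ℝ, ∀ (k : ℕ) (D : ℝ), (2 : ℝ) ^ k ≤ A * D + B → D ≤ k * δ + C → D ≤ R := by
  have hlim : Tendsto (fun k : ℕ => (A * δ) * ((k : ℝ) ^ 1 / 2 ^ k) + (A * C + B) * (1 / 2) ^ k)
      atTop (𝓝 ((A * δ) * 0 + (A * C + B) * 0)) :=
    ((tendsto_pow_const_div_const_pow_of_one_lt 1 one_lt_two).const_mul _).add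
      ((tendsto_pow_atTop_nhds_zero_of_lt_one (by norm_num) (by norm_num)).const_mul _)
  have hev := hlim.eventually (gt_mem_nhds (show (A * δ) * 0 + (A * C + B) * 0 < (1 : ℝ) by simp))
  obtain ⟨N, hN⟩ := eventually_atTop.1 hev
  refine ⟨N * δ + C, fun k D h1 h2 => ?_⟩
  have hk : k < N := by
    by_contra! hk
    have h3 := hN k hk
    have h2k : (0 : ℝ) < 2 ^ k := by positivity
    have h4 : (A * δ) * ((k : ℝ) ^ 1 / 2 ^ k) + (A * C + B) * (1 / 2) ^ k
        = (A * (k * δ + C) + B) / 2 ^ k := by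
      rw [one_div, inv_pow]
      field_simp
      ring
    rw [h4, div_lt_one h2k] at h3
    nlinarith
  have : (k : ℝ) * δ ≤ N * δ := by gcongr
  linarith

/-- In a geodesic space with thin triangles, geodesics are uniformly close to quasi-geodesics with
the same endpoints. -/
theorem HasThinTriangles.geodesic_near_quasigeodesic {δ : ℝ} (hX : HasThinTriangles X δ)
    (hδ : 0 ≤ δ) (hgeo : ∀ x y : X, ∃ S, IsGeodesicSegment x y S) {lam kap : ℝ} (hlam : 0 < lam)
    (hkap : 0 ≤ kap) :
    ∃ R : ℝ, ∀ (σ : ℝ → X) (a b : ℝ), a ≤ b →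
      (∀ s ∈ Icc a b, ∀ t ∈ Icc a b, |s - t| ≤ lam * (dist (σ s) (σ t) + kap) ∧
        dist (σ s) (σ t) ≤ lam * |s - t| + kap) →
      ∀ S, IsGeodesicSegment (σ a) (σ b) S → ∀ p ∈ S, ∃ t ∈ Icc a b, dist p (σ t) ≤ R := by
  obtain ⟨R, hR⟩ := exists_bound_of_two_pow_le (2 * (6 * lam)) (2 * (lam * (6 + kap) + 5))
    (lam + kap) δ (by positivity) hδ
  refine ⟨R + 1, fun σ a b hab hσ S hS p hp => ?_⟩
  set O : Set X := σ '' Icc a b with hO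
  have hne : O.Nonempty := ⟨_, mem_image_of_mem σ (left_mem_Icc.2 hab)⟩
  obtain ⟨x, hxS, hmax⟩ := hS.isCompact.exists_isMaxOn ⟨p, hp⟩
    (Metric.continuous_infDist_pt O).continuousOn
  set D := Metric.infDist x O with hD
  have hD0 : 0 ≤ D := Metric.infDist_nonneg
  have hnear : ∀ y ∈ S, ∃ t ∈ Icc a b, dist y (σ t) ≤ D + 1 := by
    intro y hy
    have : Metric.infDist y O < D + 1 := (hmax hy).trans_lt (by simp [D])
    obtain ⟨z, ⟨t, ht, rfl⟩, hz⟩ := (Metric.infDist_lt_iff hne).1 this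
    exact ⟨t, ht, hz.le⟩
  suffices hDR : D ≤ R by
    obtain ⟨t, ht, h⟩ := hnear p hp
    exact ⟨t, ht, by linarith⟩
  obtain ⟨u, huS, v, hvS, T, hT, hxT, hxu, hxv, hu, hv⟩ :=
    hS.exists_subsegment hxS (r := 2 * (D + 1)) (by linarith)
  have key : ∀ w ∈ S, ∀ e ∈ Icc a b, (w = σ e ∨ dist x w = 2 * (D + 1)) →
      ∃ t ∈ Icc a b, dist w (σ t) ≤ D + 1 ∧
        ∀ q, dist w q + dist q (σ t) = dist w (σ t) → D ≤ dist x q := by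
    intro w hw e he hwe
    rcases hwe with rfl | hwe
    · refine ⟨e, he, by simpa using by linarith, fun q hq => ?_⟩
      have : q = σ e := by
        rw [dist_self] at hq
        exact dist_le_zero.1 (by linarith [dist_nonneg (x := σ e) (y := q)])
      rw [this]
      exact Metric.infDist_le_dist_of_mem (mem_image_of_mem σ he)
    · obtain ⟨t, ht, h⟩ := hnear w hw
      refine ⟨t, ht, h, fun q hq => ?_⟩
      have := dist_triangle x q w
      rw [dist_comm q w] at this
      linarith [dist_nonneg (x := q) (y := σ t)]
  obtain ⟨t₁, ht₁, hut, hu'⟩ := key u huS a (left_mem_Icc.2 hab) hu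
  obtain ⟨t₂, ht₂, hvt, hv'⟩ := key v hvS b (right_mem_Icc.2 hab) hv
  have h12 : dist (σ t₁) (σ t₂) ≤ 6 * (D + 1) := by
    have h1 := dist_triangle4 (σ t₁) u v (σ t₂)
    have h2 := dist_triangle u x v
    rw [dist_comm (σ t₁) u] at h1
    rw [dist_comm u x] at h2
    linarith
  obtain ⟨N, hN⟩ : ∃ N : ℕ, N = ⌈|t₂ - t₁|⌉₊ + 1 := ⟨_, rfl⟩
  have hNlt : (N : ℝ) < |t₂ - t₁| + 2 := by
    rw [hN]; push_cast
    linarith [Nat.ceil_lt_add_one (abs_nonneg (t₂ - t₁))]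
  have hNge : |t₂ - t₁| ≤ N := by
    rw [hN]; push_cast
    linarith [Nat.le_ceil |t₂ - t₁|]
  have hN0 : (0 : ℝ) < N := by rw [hN]; positivity
  let τ : ℕ → ℝ := fun i => t₁ + (i / N) * (t₂ - t₁)
  have hτmem : ∀ i ≤ N, τ i ∈ Icc a b := by
    intro i hi
    have h0 : (0 : ℝ) ≤ i / N := by positivity
    have h1 : (i : ℝ) / N ≤ 1 := by
      rw [div_le_one hN0]
      exact_mod_cast hi
    have := (convex_Icc a b) ht₁ ht₂ (sub_nonneg.2 h1) h0 (by ring)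
    simp only [smul_eq_mul] at this
    convert this using 1
    simp only [τ]
    ring
  have hτstep : ∀ i, |τ i - τ (i + 1)| ≤ 1 := by
    intro i
    have : τ i - τ (i + 1) = -((t₂ - t₁) / N) := by
      simp only [τ]; push_cast; ring
    rw [this, abs_neg, abs_div, abs_of_pos hN0, div_le_one hN0]
    exact hNge
  let w : ℕ → X := fun i => if i = 0 then u else if i = N + 2 then v else σ (τ (i - 1))
  have hw0 : w 0 = u := by simp [w]
  have hwN : w (N + 2) = v := by simp [w]
  have hwi : ∀ i ≤ N, w (i + 1) = σ (τ i) := by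
    intro i hi
    have : i ≠ N + 1 := by omega
    simp [w, this]
  have hτ0 : τ 0 = t₁ := by simp [τ]
  have hτN : τ N = t₂ := by simp [τ, hN0.ne']
  have hTw : IsGeodesicSegment (w 0) (w (N + 2)) T := by rwa [hw0, hwN]
  set k := Nat.clog 2 (N + 2) with hk
  have hkle : N + 2 ≤ 2 ^ k := Nat.le_pow_clog (by norm_num) _
  obtain ⟨i, hi, q, hq, hxq⟩ :=
    hX.exists_near_polygon hδ hgeo k (N + 2) w T (by omega) hkle hTw x hxT
  refine hR k D ?_ ?_
  · have h2k : 2 ^ k < 2 * (N + 2) := by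
      have h1 : 2 ^ (k - 1) < N + 2 := Nat.pow_pred_clog_lt_self (b := 2) (by norm_num) (x := N + 2) (by omega)
      have hk1 : k ≠ 0 := by
        intro h0
        rw [h0] at hkle
        omega
      obtain ⟨j, hj⟩ := Nat.exists_eq_succ_of_ne_zero hk1
      rw [hj] at h1 ⊢
      simp only [Nat.succ_eq_add_one, Nat.add_sub_cancel] at h1
      rw [Nat.succ_eq_add_one, pow_succ]
      omega
    have h2k' : (2 : ℝ) ^ k ≤ 2 * (N + 2) := by exact_mod_cast h2k.le
    have h3 := (hσ t₁ ht₁ t₂ ht₂).1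
    rw [abs_sub_comm] at h3
    have h4 : lam * (dist (σ t₁) (σ t₂) + kap) ≤ lam * (6 * (D + 1) + kap) := by gcongr
    linarith
  · have hC : 0 ≤ lam + kap := by linarith
    rcases Nat.eq_zero_or_pos i with rfl | hi0
    · rw [hw0, hwi 0 (Nat.zero_le _), hτ0] at hq
      linarith [hu' q hq]
    · obtain ⟨j, rfl⟩ := Nat.exists_eq_succ_of_ne_zero hi0.ne'
      rcases Nat.lt_or_ge j N with hj | hj
      · rw [Nat.succ_eq_add_one, hwi j hj.le, hwi (j + 1) hj] at hq
        have h1 := (hσ _ (hτmem j hj.le) _ (hτmem (j + 1) hj)).2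
        have h2 : D ≤ dist x (σ (τ j)) :=
          Metric.infDist_le_dist_of_mem (mem_image_of_mem σ (hτmem j hj.le))
        have h3 := dist_triangle x q (σ (τ j))
        rw [dist_comm q] at h3
        have h4 : lam * |τ j - τ (j + 1)| ≤ lam * 1 := by gcongr; exact hτstep j
        linarith [dist_nonneg (x := q) (y := σ (τ (j + 1)))]
      · obtain rfl : j = N := by omega
        rw [Nat.succ_eq_add_one, hwi j le_rfl, hτN, show j + 1 + 1 = j + 2 from rfl, hwN] at hq
        have := hv' q (by rw [dist_comm v q, dist_comm q (σ t₂), dist_comm v (σ t₂)]; linarith)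
        linarith

/-- In a geodesic space with thin triangles, a point `x` which almost realises the distance between
`p` and `q` is close to the geodesic from `p` to `q`. -/
theorem HasThinTriangles.near_geodesic_of_dist_add_dist_le {δ : ℝ} (hX : HasThinTriangles X δ)
    (hδ : 0 ≤ δ) (hgeo : ∀ x y : X, ∃ S, IsGeodesicSegment x y S) {p q x : X} {S : Set X}
    (hS : IsGeodesicSegment p q S) {c : ℝ} (hx : dist p x + dist x q ≤ dist p q + c) :
    ∃ y ∈ S, dist x y ≤ 3 * δ + c := by
  obtain ⟨T, hT⟩ := hgeo p x
  obtain ⟨U, hU⟩ := hgeo x q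
  have hcover : S ⊆ Metric.cthickening δ T ∪ Metric.cthickening δ U := by
    intro y hy
    obtain ⟨z, hz | hz, hyz⟩ := hX q p x S T U hS.symm hT hU y hy
    · exact Or.inl (Metric.mem_cthickening_of_dist_le _ _ _ _ hz hyz)
    · exact Or.inr (Metric.mem_cthickening_of_dist_le _ _ _ _ hz hyz)
  obtain ⟨y, hyS, hyT, hyU⟩ := isPreconnected_closed_iff.1 hS.isPreconnected _ _
    Metric.isClosed_cthickening Metric.isClosed_cthickening hcover
    ⟨p, hS.left_mem, Metric.self_subset_cthickening _ hT.left_mem⟩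
    ⟨q, hS.right_mem, Metric.self_subset_cthickening _ hU.right_mem⟩
  rw [hT.isCompact.cthickening_eq_biUnion_closedBall hδ] at hyT
  rw [hU.isCompact.cthickening_eq_biUnion_closedBall hδ] at hyU
  simp only [mem_iUnion, Metric.mem_closedBall, exists_prop] at hyT hyU
  obtain ⟨u, hu, hyu⟩ := hyT
  obtain ⟨v, hv, hyv⟩ := hyU
  refine ⟨y, hyS, ?_⟩
  have h1 := hT.dist_add_dist hu
  have h2 := hU.dist_add_dist hv
  have h3 := dist_triangle4 p u v q
  have h4 := dist_triangle_left u v y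
  have h5 := dist_triangle x u y
  rw [dist_comm x u, dist_comm u y] at h5
  linarith [dist_nonneg (x := x) (y := v)]

/-- Any two points are joined by `1`-Lipschitz curves defined on intervals of length arbitrarily
close to their distance. -/
def HasApproximateGeodesics (X : Type*) [MetricSpace X] : Prop :=
  ∀ (x y : X) (ε : ℝ), 0 < ε → ∃ (σ : ℝ → X) (l : ℝ), 0 ≤ l ∧ l ≤ dist x y + ε ∧ σ 0 = x ∧ σ l = y ∧
    ∀ s ∈ Icc 0 l, ∀ t ∈ Icc 0 l, dist (σ s) (σ t) ≤ |s - t|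

theorem HasApproximateGeodesics.closedBall_subset_thickening (hX : HasApproximateGeodesics X)
    (p : X) {r r' ε : ℝ} (hr : 0 ≤ r) (hε : 0 < ε) (hr' : r' < r + ε) :
    Metric.closedBall p r' ⊆ Metric.thickening ε (Metric.closedBall p r) := by
  intro y hy
  rw [Metric.mem_closedBall, dist_comm] at hy
  rw [Metric.mem_thickening_iff]
  obtain ⟨σ, l, hl, hlε, hσ0, hσl, hσ⟩ := hX p y ((r + ε - r') / 2) (by linarith)
  by_cases h : l ≤ r
  · refine ⟨y, ?_, ?_⟩
    · have := hσ 0 (left_mem_Icc.2 hl) l (right_mem_Icc.2 hl)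
      rw [hσ0, hσl, zero_sub, abs_neg, abs_of_nonneg hl] at this
      rw [Metric.mem_closedBall, dist_comm]
      linarith
    · rwa [dist_self]
  · push Not at h
    refine ⟨σ r, ?_, ?_⟩
    · have := hσ 0 (left_mem_Icc.2 hl) r ⟨hr, h.le⟩
      rw [hσ0, zero_sub, abs_neg, abs_of_nonneg hr] at this
      rwa [Metric.mem_closedBall, dist_comm]
    · have := hσ l (right_mem_Icc.2 hl) r ⟨hr, h.le⟩
      rw [hσl, abs_of_nonneg (by linarith)] at this
      linarith

/-- The Hopf–Rinow theorem, first part: a complete locally compact length space is proper. -/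
theorem HasApproximateGeodesics.properSpace [CompleteSpace X] [LocallyCompactSpace X]
    (hX : HasApproximateGeodesics X) : ProperSpace X := by
  refine ⟨fun p => ?_⟩
  by_contra! hcon
  obtain ⟨r₀, hr₀⟩ := hcon
  set A : Set ℝ := {r | IsCompact (Metric.closedBall p r)} with hA
  have hdown : ∀ r ∈ A, ∀ r' ≤ r, r' ∈ A := fun r hr r' hr' =>
    hr.of_isClosed_subset Metric.isClosed_closedBall (Metric.closedBall_subset_closedBall hr')
  have h0 : (0 : ℝ) ∈ A := by simp [hA]
  have hbdd : BddAbove A := ⟨r₀, fun r hr => by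
    by_contra! h
    exact hr₀ (hdown r hr r₀ h.le)⟩
  set R := sSup A with hR
  have hR0 : 0 ≤ R := le_csSup hbdd h0
  have hlt : ∀ r < R, r ∈ A := by
    intro r hr
    obtain ⟨r', hr', h⟩ := exists_lt_of_lt_csSup ⟨0, h0⟩ hr
    exact hdown r' hr' r h.le
  have hRA : R ∈ A := by
    rcases hR0.eq_or_lt with h | hpos
    · rwa [← h]
    refine TotallyBounded.isCompact_of_isClosed ?_ Metric.isClosed_closedBall
    rw [Metric.totallyBounded_iff]
    intro ε hε
    have hc : max 0 (R - ε / 4) ∈ A := hlt _ (max_lt hpos (by linarith))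
    obtain ⟨t, ht, hcov⟩ := Metric.totallyBounded_iff.1 hc.totallyBounded (ε / 2) (by linarith)
    refine ⟨t, ht, fun y hy => ?_⟩
    have hy' := hX.closedBall_subset_thickening p (r := max 0 (R - ε / 4)) (ε := ε / 2)
      (le_max_left _ _) (by linarith) (by linarith [le_max_right 0 (R - ε / 4)]) hy
    obtain ⟨m, hm, hym⟩ := Metric.mem_thickening_iff.1 hy'
    obtain ⟨c, hct, hmc⟩ := mem_iUnion₂.1 (hcov hm)
    refine mem_iUnion₂.2 ⟨c, hct, ?_⟩
    rw [Metric.mem_ball] at hmc ⊢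
    linarith [dist_triangle y m c]
  obtain ⟨K, hK, hRK⟩ := exists_compact_superset (show IsCompact (Metric.closedBall p R) from hRA)
  obtain ⟨ε, hε, hεK⟩ := IsCompact.exists_thickening_subset_open
    (show IsCompact (Metric.closedBall p R) from hRA) isOpen_interior hRK
  have : R + ε / 2 ∈ A := hK.of_isClosed_subset Metric.isClosed_closedBall
    (((hX.closedBall_subset_thickening p hR0 hε (by linarith)).trans hεK).trans interior_subset)
  linarith [le_csSup hbdd this]

/-- The Hopf–Rinow theorem, second part: a proper length space is geodesic. -/
theorem HasApproximateGeodesics.exists_isGeodesicSegment [ProperSpace X]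
    (hX : HasApproximateGeodesics X) (x y : X) : ∃ S, IsGeodesicSegment x y S := by
  choose σ l hl0 hl hσ0 hσl hσ using fun n : ℕ =>
    hX x y (1 / ((n : ℝ) + 1)) Nat.one_div_pos_of_nat
  set D := dist x y with hD
  have hD0 : 0 ≤ D := dist_nonneg
  have hDl : ∀ n, D ≤ l n := by
    intro n
    have := hσ n 0 (left_mem_Icc.2 (hl0 n)) (l n) (right_mem_Icc.2 (hl0 n))
    rwa [hσ0, hσl, zero_sub, abs_neg, abs_of_nonneg (hl0 n)] at this
  have hmem : ∀ n, ∀ t ∈ Icc 0 D, t ∈ Icc 0 (l n) := fun n t ht => ⟨ht.1, ht.2.trans (hDl n)⟩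
  have hlim : ∀ t ∈ Icc 0 D, ∃ z, Tendsto (fun n => σ n t) (hyperfilter ℕ) (𝓝 z) := by
    intro t ht
    have hball : ∀ n, σ n t ∈ Metric.closedBall x D := by
      intro n
      have := hσ n t (hmem n t ht) 0 (left_mem_Icc.2 (hl0 n))
      rw [hσ0, sub_zero, abs_of_nonneg ht.1] at this
      exact this.trans ht.2
    obtain ⟨z, -, hz⟩ := (isCompact_closedBall x D).ultrafilter_le_nhds
      ((hyperfilter ℕ).map fun n => σ n t) (by
        rw [le_principal_iff]
        exact Ultrafilter.mem_map.2 (univ_mem' hball))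
    exact ⟨z, hz⟩
  have : Nonempty X := ⟨x⟩
  choose! γ hγ using hlim
  have hle : (hyperfilter ℕ : Filter ℕ) ≤ atTop := Nat.hyperfilter_le_atTop
  have heps : Tendsto (fun n : ℕ => 1 / ((n : ℝ) + 1)) (hyperfilter ℕ) (𝓝 0) :=
    tendsto_one_div_add_atTop_nhds_zero_nat.mono_left hle
  have hdist : ∀ s ∈ Icc 0 D, ∀ t ∈ Icc 0 D, s ≤ t → dist (γ s) (γ t) = t - s := by
    intro s hs t ht hst
    have h1 : Tendsto (fun n => dist (σ n s) (σ n t)) (hyperfilter ℕ) (𝓝 (dist (γ s) (γ t))) :=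
      (hγ s hs).dist (hγ t ht)
    refine le_antisymm (le_of_tendsto' h1 fun n => ?_) ?_
    · have := hσ n s (hmem n s hs) t (hmem n t ht)
      rwa [abs_of_nonpos (by linarith), neg_sub] at this
    · have h2 : Tendsto (fun n : ℕ => t - s - 1 / ((n : ℝ) + 1)) (hyperfilter ℕ) (𝓝 (t - s - 0)) :=
        tendsto_const_nhds.sub heps
      rw [sub_zero] at h2
      refine le_of_tendsto_of_tendsto' h2 h1 fun n => ?_
      have h3 := hσ n 0 (left_mem_Icc.2 (hl0 n)) s (hmem n s hs)
      have h4 := hσ n t (hmem n t ht) (l n) (right_mem_Icc.2 (hl0 n))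
      rw [hσ0, zero_sub, abs_neg, abs_of_nonneg hs.1] at h3
      rw [hσl, abs_of_nonpos (by linarith [(hmem n t ht).2])] at h4
      have h5 := dist_triangle4 x (σ n s) (σ n t) y
      linarith [hl n]
  refine ⟨_, γ, 0, D, ⟨hD0, fun s hs t ht => ?_⟩, ?_, ?_, rfl⟩
  · rcases le_total s t with h | h
    · rw [hdist s hs t ht h, abs_of_nonpos (by linarith)]
      ring
    · rw [dist_comm, hdist t ht s hs h, abs_of_nonneg (by linarith)]
  · refine tendsto_nhds_unique (hγ 0 (left_mem_Icc.2 hD0)) ?_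
    simp only [hσ0]
    exact tendsto_const_nhds
  · refine tendsto_nhds_unique (hγ D (right_mem_Icc.2 hD0)) ?_
    rw [tendsto_iff_dist_tendsto_zero]
    refine squeeze_zero (fun _ => dist_nonneg) (fun n => ?_) heps
    have := hσ n D (hmem n D (right_mem_Icc.2 hD0)) (l n) (right_mem_Icc.2 (hl0 n))
    rw [hσl, abs_of_nonpos (by linarith [hDl n])] at this
    linarith [hl n]

end MetricGeometry

section Disc

open ComplexConjugate

/-- The automorphism `ζ ↦ (ζ + a) / (1 + conj a * ζ)` of the unit disc. -/
noncomputable def discAut (a ζ : ℂ) : ℂ := (ζ + a) / (1 + conj a * ζ)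

theorem one_add_conj_mul_ne_zero {a ζ : ℂ} (ha : ‖a‖ < 1) (hζ : ‖ζ‖ < 1) : 1 + conj a * ζ ≠ 0 := by
  intro h
  have h1 : ‖conj a * ζ‖ = 1 := by
    rw [show conj a * ζ = -1 by linear_combination h]
    simp
  rw [norm_mul, RCLike.norm_conj] at h1
  nlinarith [norm_nonneg a, norm_nonneg ζ]

theorem norm_discAut_lt_one {a ζ : ℂ} (ha : ‖a‖ < 1) (hζ : ‖ζ‖ < 1) : ‖discAut a ζ‖ < 1 := by
  have hne := one_add_conj_mul_ne_zero ha hζ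
  rw [discAut, norm_div, div_lt_one (norm_pos_iff.2 hne)]
  refine lt_of_pow_lt_pow_left₀ 2 (norm_nonneg _) ?_
  have h : ‖1 + conj a * ζ‖ ^ 2 - ‖ζ + a‖ ^ 2 = (1 - ‖a‖ ^ 2) * (1 - ‖ζ‖ ^ 2) := by
    simp only [← Complex.normSq_eq_norm_sq, Complex.normSq_apply]
    simp
    ring
  have h1 : 0 < 1 - ‖a‖ ^ 2 := by nlinarith [norm_nonneg a]
  have h2 : 0 < 1 - ‖ζ‖ ^ 2 := by nlinarith [norm_nonneg ζ]
  nlinarith [mul_pos h1 h2]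

theorem mapsTo_discAut {a : ℂ} (ha : ‖a‖ < 1) :
    MapsTo (discAut a) (Metric.ball 0 1) (Metric.ball 0 1) := fun ζ hζ => by
  rw [mem_ball_zero_iff] at hζ ⊢
  exact norm_discAut_lt_one ha hζ

theorem differentiableOn_discAut {a : ℂ} (ha : ‖a‖ < 1) :
    DifferentiableOn ℂ (discAut a) (Metric.ball 0 1) := by
  intro ζ hζ
  have := one_add_conj_mul_ne_zero ha (mem_ball_zero_iff.1 hζ)
  unfold discAut
  exact DifferentiableAt.differentiableWithinAt (by fun_prop (disch := assumption))

@[simp]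
theorem discAut_zero (a : ℂ) : discAut a 0 = a := by simp [discAut]

theorem hasDerivAt_discAut_zero (a : ℂ) : HasDerivAt (discAut a) (1 - conj a * a) 0 := by
  have h1 : HasDerivAt (fun ζ : ℂ => ζ + a) 1 0 := (hasDerivAt_id _).add_const a
  have h2 : HasDerivAt (fun ζ : ℂ => 1 + conj a * ζ) (conj a * 1) 0 :=
    ((hasDerivAt_id _).const_mul (conj a)).const_add 1
  exact (h1.div h2 (by simp)).congr_deriv (by simp [mul_comm])

theorem discAut_discAut_neg {a b : ℂ} (ha : ‖a‖ < 1) (hb : ‖b‖ < 1) :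
    discAut a (discAut (-a) b) = b := by
  have h1 : 1 + conj (-a) * b ≠ 0 := one_add_conj_mul_ne_zero (by simpa) hb
  have h2 := one_add_conj_mul_ne_zero ha (norm_discAut_lt_one (a := -a) (by simpa) hb)
  rw [discAut, div_eq_iff h2, discAut]
  linear_combination div_mul_cancel₀ (b + -a) h1 -
    (b * ((b + -a) / (1 + conj (-a) * b))) * (map_neg conj a)

theorem poincareDist_eq_artanh_norm (a b : ℂ) :
    poincareDist a b = Real.artanh ‖discAut (-a) b‖ := by
  rw [poincareDist, discAut, norm_div]
  congr 2
  · rw [← norm_neg]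
    congr 1
    ring
  · rw [← RCLike.norm_conj]
    congr 1
    simp
    ring

theorem poincareDist_nonneg (a b : ℂ) : 0 ≤ poincareDist a b :=
  Real.artanh_nonneg (by positivity)

theorem poincareDist_comm (a b : ℂ) : poincareDist a b = poincareDist b a := by
  rw [poincareDist, poincareDist, norm_sub_rev a b, ← RCLike.norm_conj (1 - _)]
  simp [mul_comm]

theorem abs_tanh_lt_one (t : ℝ) : |Real.tanh t| < 1 :=
  abs_lt.2 ⟨Real.neg_one_lt_tanh t, Real.tanh_lt_one t⟩

theorem poincareDist_tanh (s t : ℝ) : poincareDist (Real.tanh s) (Real.tanh t) = |s - t| := by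
  have hs := (Real.cosh_pos s).ne'
  have ht := (Real.cosh_pos t).ne'
  have hst := (Real.cosh_pos (s - t)).ne'
  have h : (Real.tanh s - Real.tanh t) / (1 - Real.tanh t * Real.tanh s) = Real.tanh (s - t) := by
    rw [Real.tanh_eq_sinh_div_cosh, Real.tanh_eq_sinh_div_cosh, Real.tanh_eq_sinh_div_cosh (s - t)]
    have h1 : 1 - Real.sinh t / Real.cosh t * (Real.sinh s / Real.cosh s)
        = Real.cosh (s - t) / (Real.cosh s * Real.cosh t) := by
      rw [Real.cosh_sub]
      field_simp
    have h2 : Real.sinh s / Real.cosh s - Real.sinh t / Real.cosh t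
        = Real.sinh (s - t) / (Real.cosh s * Real.cosh t) := by
      rw [Real.sinh_sub]
      field_simp
    rw [h1, h2]
    field_simp
  rw [poincareDist, ← norm_div, Complex.conj_ofReal]
  norm_cast
  rw [h, Real.norm_eq_abs]
  rcases abs_cases (s - t) with ⟨h', h0⟩ | ⟨h', h0⟩
  · rw [h', abs_of_nonneg, Real.artanh_tanh]
    rw [Real.tanh_eq_sinh_div_cosh]
    exact div_nonneg (Real.sinh_nonneg_iff.2 h0) (Real.cosh_pos _).le
  · rw [h', abs_of_nonpos, ← Real.tanh_neg, Real.artanh_tanh]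
    rw [Real.tanh_eq_sinh_div_cosh]
    exact div_nonpos_of_nonpos_of_nonneg (Real.sinh_nonpos_iff.2 h0.le) (Real.cosh_pos _).le

theorem hasDerivAt_tanh (t : ℝ) : HasDerivAt Real.tanh (1 - Real.tanh t ^ 2) t := by
  have hc := (Real.cosh_pos t).ne'
  have h := (Real.hasDerivAt_sinh t).div (Real.hasDerivAt_cosh t) hc
  have h1 : Real.tanh = Real.sinh / Real.cosh := funext Real.tanh_eq_sinh_div_cosh
  rw [h1]
  refine h.congr_deriv ?_
  rw [Pi.div_apply]
  field_simp

theorem tanh_le_self {t : ℝ} (ht : 0 ≤ t) : Real.tanh t ≤ t := by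
  have hmono : Monotone fun x : ℝ => x - Real.tanh x := by
    refine monotone_of_hasDerivAt_nonneg (f' := fun x => Real.tanh x ^ 2) (fun x => ?_)
      (fun x => sq_nonneg _)
    exact ((hasDerivAt_id x).sub (hasDerivAt_tanh x)).congr_deriv (by ring)
  have := hmono ht
  simp only [Real.tanh_zero, sub_zero] at this
  linarith

variable {d : ℕ} {M : Set (CSpace d)}

theorem IsHolomorphicDisc.comp {f : ℂ → CSpace d} (hf : IsHolomorphicDisc M f) {g : ℂ → ℂ}
    (hg : DifferentiableOn ℂ g (Metric.ball 0 1))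
    (hg' : MapsTo g (Metric.ball 0 1) (Metric.ball 0 1)) : IsHolomorphicDisc M (f ∘ g) :=
  ⟨hf.1.comp hg hg', hf.2.comp hg'⟩

/-- A disc can be reparametrised so that two given points lie on the real diameter. -/
theorem IsHolomorphicDisc.exists_normalized {f : ℂ → CSpace d} (hf : IsHolomorphicDisc M f)
    {a b : ℂ} (ha : a ∈ Metric.ball (0 : ℂ) 1) (hb : b ∈ Metric.ball (0 : ℂ) 1) :
    ∃ g, IsHolomorphicDisc M g ∧ g 0 = f a ∧ g (Real.tanh (poincareDist a b)) = f b := by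
  rw [mem_ball_zero_iff] at ha hb
  set w := discAut (-a) b with hw
  have hw1 : ‖w‖ < 1 := norm_discAut_lt_one (by simpa) hb
  obtain ⟨u, hu, huw⟩ : ∃ u : ℂ, ‖u‖ = 1 ∧ u * ‖w‖ = w := by
    by_cases h : w = 0
    · exact ⟨1, by simp, by simp [h]⟩
    · refine ⟨w / ‖w‖, ?_, ?_⟩
      · rw [norm_div, Complex.norm_real, norm_norm, div_self (norm_ne_zero_iff.2 h)]
      · exact div_mul_cancel₀ _ (by simpa using h)
  have hmul : MapsTo (fun ζ => u * ζ) (Metric.ball (0 : ℂ) 1) (Metric.ball 0 1) := by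
    intro ζ hζ
    rw [mem_ball_zero_iff] at hζ ⊢
    simpa [hu] using hζ
  refine ⟨_, (hf.comp (differentiableOn_discAut ha) (mapsTo_discAut ha)).comp
    (g := fun ζ => u * ζ) (by fun_prop) hmul, by simp, ?_⟩
  rw [poincareDist_eq_artanh_norm, Real.tanh_artanh ⟨by linarith [norm_nonneg w], hw1⟩]
  simp only [Function.comp_apply]
  rw [huw, hw, discAut_discAut_neg ha hb]

theorem ofReal_tanh_mem_ball (t : ℝ) : (Real.tanh t : ℂ) ∈ Metric.ball (0 : ℂ) 1 := by
  rw [mem_ball_zero_iff, Complex.norm_real]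
  exact abs_tanh_lt_one t

/-- The image of the real diameter, parametrised by hyperbolic arc length, has unit speed at most
`1` for the Kobayashi–Royden metric. -/
theorem IsHolomorphicDisc.kobayashiRoyden_tanh_le {f : ℂ → CSpace d} (hf : IsHolomorphicDisc M f)
    (t : ℝ) : DifferentiableAt ℝ (fun s : ℝ => f (Real.tanh s)) t ∧
      kobayashiRoyden M (f (Real.tanh t)) (deriv (fun s : ℝ => f (Real.tanh s)) t) ≤ 1 := by
  set x : ℂ := ((Real.tanh t : ℝ) : ℂ) with hx
  have hxb : x ∈ Metric.ball (0 : ℂ) 1 := ofReal_tanh_mem_ball t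
  have hfx : HasDerivAt f (deriv f x) x :=
    (hf.1.differentiableAt (Metric.isOpen_ball.mem_nhds hxb)).hasDerivAt
  have hτ : HasDerivAt (fun s : ℝ => ((Real.tanh s : ℝ) : ℂ)) ((1 - Real.tanh t ^ 2 : ℝ) : ℂ) t :=
    (hasDerivAt_tanh t).ofReal_comp
  have hd : HasDerivAt (fun s : ℝ => f (Real.tanh s)) (((1 - Real.tanh t ^ 2 : ℝ) : ℂ) • deriv f x) t :=
    hfx.scomp t hτ
  refine ⟨hd.differentiableAt, ?_⟩
  rw [hd.deriv]
  have hx1 : ‖x‖ < 1 := mem_ball_zero_iff.1 hxb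
  refine sInf_le ⟨f ∘ discAut x, 1, hf.comp (differentiableOn_discAut hx1) (mapsTo_discAut hx1),
    by simp, ?_, by simp⟩
  have h := hasDerivAt_discAut_zero x
  have h' : HasDerivAt (f ∘ discAut x) ((1 - conj x * x) • deriv f x) 0 := by
    refine HasDerivAt.scomp 0 ?_ h
    rwa [discAut_zero]
  rw [h'.deriv, one_smul, hx, Complex.conj_ofReal]
  congr 1
  push_cast
  ring

theorem IsHolomorphicDisc.norm_sub_le {f : ℂ → CSpace d} (hf : IsHolomorphicDisc M f) {C : ℝ}
    (hC : ∀ z ∈ M, ∀ w ∈ M, ‖z - w‖ ≤ C) {a b : ℂ} (ha : a ∈ Metric.ball (0 : ℂ) 1)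
    (hb : b ∈ Metric.ball (0 : ℂ) 1) : ‖f a - f b‖ ≤ C * poincareDist a b := by
  obtain ⟨g, hg, hg0, hgl⟩ := hf.exists_normalized ha hb
  have h0 : (0 : ℂ) ∈ Metric.ball (0 : ℂ) 1 := by simp
  have hmaps : MapsTo g (Metric.ball 0 1) (Metric.closedBall (g 0) C) := by
    intro ζ hζ
    rw [Metric.mem_closedBall, dist_eq_norm]
    exact hC _ (hg.2 hζ) _ (hg.2 h0)
  have h := Complex.dist_le_div_mul_dist_of_mapsTo_ball hg.1 hmaps
    (ofReal_tanh_mem_ball (poincareDist a b))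
  have hC0 : 0 ≤ C := (norm_nonneg _).trans (hC _ (hg.2 h0) _ (hg.2 h0))
  have hp := poincareDist_nonneg a b
  have ht : 0 ≤ Real.tanh (poincareDist a b) := by
    rw [Real.tanh_eq_sinh_div_cosh]
    exact div_nonneg (Real.sinh_nonneg_iff.2 hp) (Real.cosh_pos _).le
  rw [hg0, hgl, dist_zero_right, Complex.norm_real, Real.norm_of_nonneg ht, div_one, dist_comm,
    dist_eq_norm] at h
  exact h.trans (by gcongr; exact tanh_le_self hp)

end Disc

section Chains

variable {d : ℕ} {M : Set (CSpace d)}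

theorem IsDiscChainLength.nonneg {z w : CSpace d} {c : ℝ} (h : IsDiscChainLength M z w c) :
    0 ≤ c := by
  obtain ⟨n, p, f, a, b, -, -, -, rfl⟩ := h
  exact Finset.sum_nonneg fun j _ => poincareDist_nonneg _ _

theorem isDiscChainLength_self (z : CSpace d) : IsDiscChainLength M z z 0 :=
  ⟨0, fun _ => z, fun _ _ => z, fun _ => 0, fun _ => 0, rfl, rfl, by simp, by simp⟩

theorem IsHolomorphicDisc.isDiscChainLength {f : ℂ → CSpace d} (hf : IsHolomorphicDisc M f)
    {a b : ℂ} (ha : a ∈ Metric.ball (0 : ℂ) 1) (hb : b ∈ Metric.ball (0 : ℂ) 1) :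
    IsDiscChainLength M (f a) (f b) (poincareDist a b) := by
  refine ⟨1, fun j => if j = 0 then f a else f b, fun _ => f, fun _ => a, fun _ => b, rfl, rfl,
    fun j hj => ?_, by simp⟩
  obtain rfl : j = 0 := by omega
  exact ⟨hf, ha, hb, rfl, rfl⟩

theorem IsDiscChainLength.symm {z w : CSpace d} {c : ℝ} (h : IsDiscChainLength M z w c) :
    IsDiscChainLength M w z c := by
  obtain ⟨n, p, f, a, b, rfl, rfl, h, rfl⟩ := h
  refine ⟨n, fun j => p (n - j), fun j => f (n - 1 - j), fun j => b (n - 1 - j),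
    fun j => a (n - 1 - j), by simp, by simp, fun j hj => ?_, ?_⟩
  · obtain ⟨h1, h2, h3, h4, h5⟩ := h (n - 1 - j) (by omega)
    exact ⟨h1, h3, h2, h5.trans (congrArg p (by omega)), h4.trans (congrArg p (by omega))⟩
  · rw [← Finset.sum_range_reflect]
    exact Finset.sum_congr rfl fun j _ => poincareDist_comm _ _

theorem IsDiscChainLength.trans {z w v : CSpace d} {c e : ℝ} (h : IsDiscChainLength M z w c)
    (h' : IsDiscChainLength M w v e) : IsDiscChainLength M z v (c + e) := by
  obtain ⟨n, p, f, a, b, rfl, rfl, h, rfl⟩ := h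
  obtain ⟨m, p', f', a', b', hp, rfl, h', rfl⟩ := h'
  refine ⟨n + m, fun j => if j < n then p j else p' (j - n), fun j => if j < n then f j else f' (j - n),
    fun j => if j < n then a j else a' (j - n), fun j => if j < n then b j else b' (j - n),
    ?_, by simp, fun j hj => ?_, ?_⟩
  · rcases Nat.eq_zero_or_pos n with rfl | hn
    · simp [hp]
    · simp [hn]
  · by_cases hjn : j < n
    · obtain ⟨h1, h2, h3, h4, h5⟩ := h j hjn
      simp only [hjn, if_true]
      refine ⟨h1, h2, h3, h4, ?_⟩
      split_ifs with hj1
      · exact h5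
      · obtain rfl : n = j + 1 := by omega
        simpa [hp] using h5
    · obtain ⟨h1, h2, h3, h4, h5⟩ := h' (j - n) (by omega)
      have hj1 : ¬ j + 1 < n := by omega
      simp only [hjn, hj1, if_false]
      refine ⟨h1, h2, h3, h4, ?_⟩
      rw [h5]
      congr 1
      omega
  · rw [Finset.sum_range_add]
    congr 1
    · exact Finset.sum_congr rfl fun j hj => by simp [Finset.mem_range.1 hj]
    · exact Finset.sum_congr rfl fun j hj => by simp

theorem IsDiscChainLength.kobayashiDist_le {z w : CSpace d} {c : ℝ}
    (h : IsDiscChainLength M z w c) : kobayashiDist M z w ≤ c :=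
  csInf_le ⟨0, fun _ h => h.nonneg⟩ h

theorem kobayashiDist_nonneg (z w : CSpace d) : 0 ≤ kobayashiDist M z w :=
  Real.sInf_nonneg fun _ h => IsDiscChainLength.nonneg h

theorem kobayashiDist_self (z : CSpace d) : kobayashiDist M z z = 0 :=
  le_antisymm (isDiscChainLength_self z).kobayashiDist_le (kobayashiDist_nonneg z z)

theorem kobayashiDist_comm (z w : CSpace d) : kobayashiDist M z w = kobayashiDist M w z := by
  unfold kobayashiDist
  congr 1
  ext c
  exact ⟨fun h => h.symm, fun h => h.symm⟩

/-- Any two points of `M` are joined by a chain of discs. -/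
def IsDiscChainConnected (M : Set (CSpace d)) : Prop :=
  ∀ z ∈ M, ∀ w ∈ M, ∃ c, IsDiscChainLength M z w c

theorem IsDiscChainConnected.exists_lt (hM : IsDiscChainConnected M) {z w : CSpace d} (hz : z ∈ M)
    (hw : w ∈ M) {ε : ℝ} (hε : 0 < ε) :
    ∃ c < kobayashiDist M z w + ε, IsDiscChainLength M z w c := by
  obtain ⟨c, hc, h⟩ := exists_lt_of_csInf_lt (hM z hz w hw)
    (show kobayashiDist M z w < kobayashiDist M z w + ε by linarith)
  exact ⟨c, h, hc⟩

theorem IsDiscChainConnected.kobayashiDist_triangle (hM : IsDiscChainConnected M) {z w v : CSpace d}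
    (hz : z ∈ M) (hw : w ∈ M) (hv : v ∈ M) :
    kobayashiDist M z v ≤ kobayashiDist M z w + kobayashiDist M w v := by
  refine le_of_forall_pos_le_add fun ε hε => ?_
  obtain ⟨c, hc, h⟩ := hM.exists_lt hz hw (half_pos hε)
  obtain ⟨e, he, h'⟩ := hM.exists_lt hw hv (half_pos hε)
  linarith [(h.trans h').kobayashiDist_le]

theorem IsDiscChainLength.norm_sub_le {C : ℝ} (hC : ∀ z ∈ M, ∀ w ∈ M, ‖z - w‖ ≤ C)
    {z w : CSpace d} {c : ℝ} (h : IsDiscChainLength M z w c) : ‖z - w‖ ≤ C * c := by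
  obtain ⟨n, p, f, a, b, rfl, rfl, h, rfl⟩ := h
  induction n with
  | zero => simp
  | succ n ih =>
    obtain ⟨h1, h2, h3, h4, h5⟩ := h n (Nat.lt_succ_self n)
    have h6 := h1.norm_sub_le hC h2 h3
    rw [h4, h5] at h6
    rw [Finset.sum_range_succ, mul_add]
    linarith [ih fun j hj => h j (hj.trans (Nat.lt_succ_self n)),
      norm_sub_le_norm_sub_add_norm_sub (p 0) (p n) (p (n + 1))]

theorem IsDiscChainConnected.norm_sub_le (hM : IsDiscChainConnected M) {C : ℝ} (hC0 : 0 < C)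
    (hC : ∀ z ∈ M, ∀ w ∈ M, ‖z - w‖ ≤ C) {z w : CSpace d} (hz : z ∈ M) (hw : w ∈ M) :
    ‖z - w‖ ≤ C * kobayashiDist M z w := by
  refine le_of_forall_pos_le_add fun ε hε => ?_
  obtain ⟨c, hc, h⟩ := hM.exists_lt hz hw (div_pos hε hC0)
  have h1 := h.norm_sub_le hC
  have h2 : C * c ≤ C * (kobayashiDist M z w + ε / C) := by gcongr
  rw [mul_add, mul_div_cancel₀ _ hC0.ne'] at h2
  linarith

/-- Nearby points of a submanifold are joined by short chains of discs. -/
theorem IsEmbeddedComplexSubmanifold.eventually_isDiscChainLength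
    (hsub : IsEmbeddedComplexSubmanifold M) {p : CSpace d} (hp : p ∈ M) {ε : ℝ} (hε : 0 < ε) :
    ∀ᶠ z in 𝓝[M] p, IsDiscChainLength M p z ε := by
  obtain ⟨Φ, L, hpΦ, -, hΦs, hML⟩ := hsub p hp
  obtain ⟨r, hr, hball⟩ := Metric.isOpen_iff.1 Φ.open_target (Φ p) (Φ.map_source hpΦ)
  set t := Real.tanh ε with ht
  have ht0 : 0 < t := by
    rw [ht, Real.tanh_eq_sinh_div_cosh]
    exact div_pos (Real.sinh_pos_iff.2 hε) (Real.cosh_pos _)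
  have hcont : Tendsto Φ (𝓝 p) (𝓝 (Φ p)) := Φ.continuousAt hpΦ
  have h1 := hcont.eventually (Metric.ball_mem_nhds (Φ p) (mul_pos hr ht0))
  filter_upwards [nhdsWithin_le_nhds h1, nhdsWithin_le_nhds (Φ.open_source.mem_nhds hpΦ),
    self_mem_nhdsWithin] with z hz hzs hzM
  set v := Φ z - Φ p with hv
  have hvr : ‖v‖ < r * t := by simpa [dist_eq_norm] using hz
  have hvL : v ∈ L := L.sub_mem ((hML z hzs).1 hzM) ((hML p hpΦ).1 hp)
  have htC : (t : ℂ) ≠ 0 := by exact_mod_cast ht0.ne'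
  let g : ℂ → CSpace d := fun ζ => Φ p + (ζ / t) • v
  have hg : MapsTo g (Metric.ball 0 1) Φ.target := by
    intro ζ hζ
    refine hball ?_
    rw [mem_ball_zero_iff] at hζ
    rw [Metric.mem_ball, dist_eq_norm]
    simp only [g, add_sub_cancel_left, norm_smul, norm_div, Complex.norm_real, Real.norm_eq_abs,
      abs_of_pos ht0]
    rw [div_mul_eq_mul_div, div_lt_iff₀ ht0]
    nlinarith [norm_nonneg v, norm_nonneg ζ]
  have hdisc : IsHolomorphicDisc M (Φ.symm ∘ g) := by
    refine ⟨hΦs.comp (by fun_prop) hg, fun ζ hζ => ?_⟩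
    rw [Function.comp_apply, hML _ (Φ.map_target (hg hζ)), Φ.right_inv (hg hζ)]
    exact L.add_mem ((hML p hpΦ).1 hp) (L.smul_mem _ hvL)
  have h := hdisc.isDiscChainLength (ofReal_tanh_mem_ball 0) (ofReal_tanh_mem_ball ε)
  rw [poincareDist_tanh, zero_sub, abs_neg, abs_of_pos hε] at h
  have e0 : (Φ.symm ∘ g) ((Real.tanh 0 : ℝ) : ℂ) = p := by
    simp [g, Φ.left_inv hpΦ]
  have e1 : (Φ.symm ∘ g) ((Real.tanh ε : ℝ) : ℂ) = z := by
    simp only [Function.comp_apply, g]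
    rw [← ht, div_self htC, one_smul, hv, add_sub_cancel, Φ.left_inv hzs]
  rwa [e0, e1] at h

theorem IsEmbeddedComplexSubmanifold.isDiscChainConnected (hsub : IsEmbeddedComplexSubmanifold M)
    (hconn : IsConnected M) : IsDiscChainConnected M := by
  intro z hz w hw
  refine hconn.isPreconnected.induction₂ (fun z w => ∃ c, IsDiscChainLength M z w c)
    (fun x hx => ?_) ?_ ?_ hz hw
  · filter_upwards [hsub.eventually_isDiscChainLength hx one_pos] with y hy
    exact ⟨1, hy⟩
  · rintro x y z - - - ⟨c, h⟩ ⟨e, h'⟩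
    exact ⟨c + e, h.trans h'⟩
  · rintro x y - - ⟨c, h⟩
    exact ⟨c, h.symm⟩

/-- A curve in `M` of length at most `c` joins `z` to `w`: it is `1`-Lipschitz for the Kobayashi
distance and, off a finite set, differentiable with Kobayashi–Royden speed at most `1`. -/
def IsUnitSpeedCurve (M : Set (CSpace d)) (z w : CSpace d) (c : ℝ) (σ : ℝ → CSpace d) : Prop :=
  0 ≤ c ∧ σ 0 = z ∧ σ c = w ∧ MapsTo σ (Icc 0 c) M ∧
    (∀ s ∈ Icc 0 c, ∀ t ∈ Icc 0 c, kobayashiDist M (σ s) (σ t) ≤ |s - t|) ∧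
    ∃ F : Set ℝ, F.Finite ∧ ∀ t ∈ Icc 0 c, t ∉ F →
      DifferentiableAt ℝ σ t ∧ kobayashiRoyden M (σ t) (deriv σ t) ≤ 1

theorem IsHolomorphicDisc.exists_isUnitSpeedCurve {f : ℂ → CSpace d} (hf : IsHolomorphicDisc M f)
    {a b : ℂ} (ha : a ∈ Metric.ball (0 : ℂ) 1) (hb : b ∈ Metric.ball (0 : ℂ) 1) :
    ∃ σ, IsUnitSpeedCurve M (f a) (f b) (poincareDist a b) σ := by
  obtain ⟨g, hg, hg0, hgl⟩ := hf.exists_normalized ha hb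
  refine ⟨fun t => g (Real.tanh t), poincareDist_nonneg a b, by simpa using hg0, hgl,
    fun t _ => hg.2 (ofReal_tanh_mem_ball t), fun s _ t _ => ?_, ∅, finite_empty, fun t _ _ =>
    hg.kobayashiRoyden_tanh_le t⟩
  rw [← poincareDist_tanh]
  exact (hg.isDiscChainLength (ofReal_tanh_mem_ball s) (ofReal_tanh_mem_ball t)).kobayashiDist_le

theorem IsUnitSpeedCurve.trans (hM : IsDiscChainConnected M) {z w v : CSpace d} {c e : ℝ}
    {σ τ : ℝ → CSpace d} (hσ : IsUnitSpeedCurve M z w c σ) (hτ : IsUnitSpeedCurve M w v e τ) :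
    ∃ ρ, IsUnitSpeedCurve M z v (c + e) ρ := by
  obtain ⟨hc, rfl, hσc, hσM, hσk, F, hF, hσd⟩ := hσ
  obtain ⟨he, hτ0, rfl, hτM, hτk, G, hG, hτd⟩ := hτ
  let ρ : ℝ → CSpace d := fun t => if t ≤ c then σ t else τ (t - c)
  have hρ1 : ∀ t ≤ c, ρ t = σ t := fun t ht => if_pos ht
  have hρ2 : ∀ t, c ≤ t → ρ t = τ (t - c) := by
    intro t ht
    rcases ht.eq_or_lt with rfl | ht
    · rw [hρ1 _ le_rfl, sub_self, hσc, hτ0]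
    · exact if_neg ht.not_ge
  have hρM : MapsTo ρ (Icc 0 (c + e)) M := by
    intro t ht
    rcases le_total t c with h | h
    · rw [hρ1 t h]
      exact hσM ⟨ht.1, h⟩
    · rw [hρ2 t h]
      exact hτM ⟨by linarith, by linarith [ht.2]⟩
  have hcM : ρ c ∈ M := hρM ⟨hc, by linarith⟩
  have hk : ∀ s ∈ Icc 0 (c + e), ∀ t ∈ Icc 0 (c + e), s ≤ t →
      kobayashiDist M (ρ s) (ρ t) ≤ |s - t| := by
    intro s hs t ht hst
    have h1 : ∀ s ∈ Icc 0 c, ∀ t ∈ Icc 0 c, kobayashiDist M (ρ s) (ρ t) ≤ |s - t| := by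
      intro s hs t ht
      rw [hρ1 s hs.2, hρ1 t ht.2]
      exact hσk s hs t ht
    have h2 : ∀ s ∈ Icc c (c + e), ∀ t ∈ Icc c (c + e), kobayashiDist M (ρ s) (ρ t) ≤ |s - t| := by
      intro s hs t ht
      rw [hρ2 s hs.1, hρ2 t ht.1, show s - t = (s - c) - (t - c) by ring]
      exact hτk _ ⟨by linarith [hs.1], by linarith [hs.2]⟩ _ ⟨by linarith [ht.1], by linarith [ht.2]⟩
    rcases le_total t c with h | h
    · exact h1 s ⟨hs.1, hst.trans h⟩ t ⟨ht.1, h⟩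
    rcases le_total c s with h' | h'
    · exact h2 s ⟨h', hs.2⟩ t ⟨h, ht.2⟩
    have h3 := h1 s ⟨hs.1, h'⟩ c ⟨hc, le_rfl⟩
    have h4 := h2 c ⟨le_rfl, by linarith⟩ t ⟨h, ht.2⟩
    rw [abs_of_nonpos (by linarith)] at h3 h4 ⊢
    linarith [hM.kobayashiDist_triangle (hρM hs) hcM (hρM ht)]
  refine ⟨ρ, by linarith, hρ1 0 hc, ?_, hρM, fun s hs t ht => ?_,
    F ∪ {c} ∪ (fun t => t + c) '' G, (hF.union (finite_singleton c)).union (hG.image _), ?_⟩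
  · rw [hρ2 _ (by linarith), add_sub_cancel_left]
  · rcases le_total s t with h | h
    · exact hk s hs t ht h
    · rw [kobayashiDist_comm, abs_sub_comm]
      exact hk t ht s hs h
  · intro t ht htF
    simp only [mem_union, mem_singleton_iff, not_or, mem_image, not_exists, not_and] at htF
    obtain ⟨⟨htF, htc⟩, htG⟩ := htF
    rcases lt_or_gt_of_ne htc with h | h
    · have heq : ρ =ᶠ[𝓝 t] σ := by
        filter_upwards [gt_mem_nhds h] with s hs using hρ1 s hs.le
      obtain ⟨h1, h2⟩ := hσd t ⟨ht.1, h.le⟩ htF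
      rw [heq.differentiableAt_iff, heq.deriv_eq, heq.eq_of_nhds]
      exact ⟨h1, h2⟩
    · have heq : ρ =ᶠ[𝓝 t] fun s => τ (s - c) := by
        filter_upwards [lt_mem_nhds h] with s hs using hρ2 s hs.le
      obtain ⟨h1, h2⟩ := hτd (t - c) ⟨by linarith, by linarith [ht.2]⟩
        (fun hG => htG _ hG (by ring))
      rw [heq.differentiableAt_iff, heq.deriv_eq, heq.eq_of_nhds, deriv_comp_sub_const]
      exact ⟨differentiableAt_comp_sub_const.2 h1, h2⟩

theorem IsDiscChainLength.exists_isUnitSpeedCurve (hM : IsDiscChainConnected M) {z w : CSpace d}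
    {c : ℝ} (hz : z ∈ M) (h : IsDiscChainLength M z w c) : ∃ σ, IsUnitSpeedCurve M z w c σ := by
  obtain ⟨n, p, f, a, b, rfl, rfl, h, rfl⟩ := h
  induction n with
  | zero =>
    refine ⟨fun _ => p 0, by simp, rfl, rfl, fun _ _ => hz, ?_, {0}, finite_singleton _, ?_⟩
    · simp [kobayashiDist_self]
    · simp only [Finset.range_zero, Finset.sum_empty, Icc_self, mem_singleton_iff]
      exact fun t h h' => absurd h h'
  | succ n ih =>
    obtain ⟨σ, hσ⟩ := ih fun j hj => h j (hj.trans (Nat.lt_succ_self n))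
    obtain ⟨h1, h2, h3, h4, h5⟩ := h n (Nat.lt_succ_self n)
    obtain ⟨τ, hτ⟩ := h1.exists_isUnitSpeedCurve h2 h3
    rw [h4, h5] at hτ
    rw [Finset.sum_range_succ]
    exact hσ.trans hM hτ

theorem IsDiscChainConnected.exists_isUnitSpeedCurve (hM : IsDiscChainConnected M) {z w : CSpace d}
    (hz : z ∈ M) (hw : w ∈ M) {ε : ℝ} (hε : 0 < ε) :
    ∃ c ≤ kobayashiDist M z w + ε, ∃ σ, IsUnitSpeedCurve M z w c σ := by
  obtain ⟨c, hc, h⟩ := hM.exists_lt hz hw hε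
  exact ⟨c, hc.le, h.exists_isUnitSpeedCurve hM hz⟩

/-- A curve of almost minimal length, parametrised by arc length, is an almost-geodesic. -/
theorem IsUnitSpeedCurve.isAlmostGeodesic (hM : IsDiscChainConnected M)
    (hbdd : Bornology.IsBounded M) {z w : CSpace d} {c lam kap : ℝ} {σ : ℝ → CSpace d}
    (hσ : IsUnitSpeedCurve M z w c σ) (hc : c ≤ kobayashiDist M z w + kap) (hlam : 1 ≤ lam)
    (hkap : 0 ≤ kap) : IsAlmostGeodesic M lam kap σ 0 c := by
  obtain ⟨hc0, rfl, rfl, hσM, hσk, F, hF, hσd⟩ := hσ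
  have h0 : (0 : ℝ) ∈ Icc 0 c := left_mem_Icc.2 hc0
  have hcm : c ∈ Icc 0 c := right_mem_Icc.2 hc0
  have hlow : ∀ s ∈ Icc 0 c, ∀ t ∈ Icc 0 c, s ≤ t → t - s - kap ≤ kobayashiDist M (σ s) (σ t) := by
    intro s hs t ht hst
    have h1 := hσk 0 h0 s hs
    have h2 := hσk t ht c hcm
    rw [abs_of_nonpos (by linarith [hs.1])] at h1
    rw [abs_of_nonpos (by linarith [ht.2])] at h2
    linarith [hM.kobayashiDist_triangle (hσM h0) (hσM hs) (hσM hcm),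
      hM.kobayashiDist_triangle (hσM hs) (hσM ht) (hσM hcm)]
  refine ⟨hc0, hσM, fun s hs t ht => ⟨?_, ?_⟩, ?_, ?_⟩
  · have h1 : 1 / lam * |t - s| ≤ |t - s| :=
      mul_le_of_le_one_left (abs_nonneg _) (by rw [div_le_one (by linarith)]; exact hlam)
    rcases le_total s t with h | h
    · rw [kobayashiDist_comm]
      rw [abs_of_nonneg (by linarith)] at h1 ⊢
      linarith [hlow s hs t ht h]
    · rw [abs_of_nonpos (by linarith)] at h1 ⊢
      linarith [hlow t ht s hs h]
  · have h1 : |t - s| ≤ lam * |t - s| := le_mul_of_one_le_left (abs_nonneg _) hlam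
    linarith [hσk t ht s hs]
  · obtain ⟨C, hC⟩ := Metric.isBounded_iff.1 hbdd
    have hC' : ∀ z ∈ M, ∀ w ∈ M, ‖z - w‖ ≤ max C 1 := fun z hz w hw => by
      rw [← dist_eq_norm]
      exact (hC hz hw).trans (le_max_left _ _)
    refine LipschitzOnWith.absolutelyContinuousOnInterval (K := (max C 1).toNNReal) ?_
    rw [uIcc_of_le hc0]
    refine LipschitzOnWith.of_dist_le_mul fun s hs t ht => ?_
    have hpos : 0 < max C 1 := lt_max_of_lt_right one_pos
    rw [Real.coe_toNNReal _ hpos.le, dist_eq_norm, Real.dist_eq]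
    exact (hM.norm_sub_le hpos hC' (hσM hs) (hσM ht)).trans (by gcongr; exact hσk s hs t ht)
  · rw [ae_restrict_iff' measurableSet_Icc]
    filter_upwards [hF.countable.ae_notMem volume] with t htF ht
    obtain ⟨h1, h2⟩ := hσd t ht htF
    exact ⟨h1, h2.trans (by simpa using ENNReal.ofReal_le_ofReal hlam)⟩

end Chains

section KobayashiSpace

variable {d : ℕ} {M : Set (CSpace d)}

/-- The points of `M`, to be endowed with the Kobayashi distance. -/
@[ext]
structure KobayashiPoint {d : ℕ} (M : Set (CSpace d)) where
  /-- The underlying point of `ℂ^d`. -/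
  val : CSpace d
  property : val ∈ M

/-- The Kobayashi distance of a bounded submanifold is a distance. -/
@[reducible]
noncomputable def kobayashiMetricSpace (hM : IsDiscChainConnected M) {C : ℝ} (hC0 : 0 < C)
    (hC : ∀ z ∈ M, ∀ w ∈ M, ‖z - w‖ ≤ C) : MetricSpace (KobayashiPoint M) where
  dist p q := kobayashiDist M p.val q.val
  dist_self p := kobayashiDist_self p.val
  dist_comm p q := kobayashiDist_comm p.val q.val
  dist_triangle p q r := hM.kobayashiDist_triangle p.property q.property r.property
  eq_of_dist_eq_zero {p q} h := by
    have h1 := hM.norm_sub_le hC0 hC p.property q.property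
    change kobayashiDist M p.val q.val = 0 at h
    rw [h, mul_zero] at h1
    exact KobayashiPoint.ext (sub_eq_zero.1 (norm_le_zero_iff.1 h1))

/-- The Kobayashi distance of a bounded submanifold induces its topology. -/
noncomputable def kobayashiHomeomorph (hsub : IsEmbeddedComplexSubmanifold M)
    (hM : IsDiscChainConnected M) {C : ℝ} (hC0 : 0 < C) (hC : ∀ z ∈ M, ∀ w ∈ M, ‖z - w‖ ≤ C) :
    letI := kobayashiMetricSpace hM hC0 hC
    M ≃ₜ KobayashiPoint M :=
  letI := kobayashiMetricSpace hM hC0 hC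
  { toFun := fun z => ⟨z.1, z.2⟩
    invFun := fun p => ⟨p.val, p.property⟩
    left_inv := fun _ => rfl
    right_inv := fun _ => rfl
    continuous_toFun := by
      rw [continuous_iff_continuousAt]
      intro p
      rw [ContinuousAt, Metric.tendsto_nhds]
      intro ε hε
      have h := hsub.eventually_isDiscChainLength p.2 (half_pos hε)
      rw [nhdsWithin_eq_map_subtype_coe p.2, eventually_map] at h
      filter_upwards [h] with z hz
      rw [dist_comm]
      exact hz.kobayashiDist_le.trans_lt (half_lt_self hε)
    continuous_invFun := by
      refine Continuous.subtype_mk ?_ _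
      have : LipschitzWith C.toNNReal (KobayashiPoint.val : KobayashiPoint M → CSpace d) := by
        refine LipschitzWith.of_dist_le_mul fun p q => ?_
        rw [Real.coe_toNNReal _ hC0.le, dist_eq_norm]
        exact hM.norm_sub_le hC0 hC p.property q.property
      exact this.continuous }

theorem IsEmbeddedComplexSubmanifold.isLocallyClosed (hsub : IsEmbeddedComplexSubmanifold M) :
    IsLocallyClosed M := by
  refine ((isLocallyClosed_tfae M).out 0 2).2 fun p hp => ?_
  obtain ⟨Φ, L, hpΦ, -, -, hML⟩ := hsub p hp
  refine ⟨Φ.source, Φ.open_source.mem_nhds hpΦ, ?_⟩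
  have hL : IsClosed (L : Set (CSpace d)) := L.closed_of_finiteDimensional
  have : (Subtype.val ⁻¹' M : Set Φ.source) = Φ.source.domRestrict Φ ⁻¹' L := by
    ext z
    exact hML z.1 z.2
  rw [this]
  exact hL.preimage (continuousOn_iff_continuous_domRestrict.1 Φ.continuousOn)

/-- Visibility passes from one class of curves to another when each curve of the second is
accompanied by one of the first with the same endpoints, at bounded distance from it. -/
theorem HasVisibility.of_near {C₁ C₂ : (ℝ → CSpace d) → ℝ → ℝ → Prop} (h : HasVisibility M C₁)
    (hprop : ∀ (R : ℝ) (K : Set (CSpace d)), K ⊆ M → IsCompact K → ∃ K' ⊆ M, IsCompact K' ∧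
      ∀ x ∈ K, ∀ y ∈ M, kobayashiDist M x y ≤ R → y ∈ K')
    (hnear : ∃ R : ℝ, ∀ σ a b, C₂ σ a b → σ a ≠ σ b → ∃ τ a' b', C₁ τ a' b' ∧ τ a' = σ a ∧
      τ b' = σ b ∧ ∀ t ∈ Icc a' b', ∃ s ∈ Icc a b, σ s ∈ M ∧ kobayashiDist M (τ t) (σ s) ≤ R) :
    HasVisibility M C₂ := by
  intro p hp q hq hpq
  obtain ⟨V, hV, W, hW, K, hVW, hKM, hK, hvis⟩ := h p hp q hq hpq
  obtain ⟨R, hR⟩ := hnear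
  obtain ⟨K', hK'M, hK', hKK'⟩ := hprop R K hKM hK
  refine ⟨V, hV, W, hW, K', hVW, hK'M, hK', fun σ a b hσ ha hb => ?_⟩
  have hne : σ a ≠ σ b := by
    intro heq
    have : σ a ∈ closure V ∩ closure W := ⟨subset_closure ha, heq ▸ subset_closure hb⟩
    rw [hVW] at this
    exact this
  obtain ⟨τ, a', b', hτ, hτa, hτb, hnear⟩ := hR σ a b hσ hne
  obtain ⟨t, ht, htK⟩ := hvis τ a' b' hτ (hτa ▸ ha) (hτb ▸ hb)
  obtain ⟨s, hs, hsM, hst⟩ := hnear t ht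
  exact ⟨s, hs, hKK' _ htK _ hsM hst⟩

/-- A curve in `M` as a curve in the metric space of its points. -/
noncomputable def liftCurve (p₀ : KobayashiPoint M) (σ : ℝ → CSpace d) (t : ℝ) : KobayashiPoint M :=
  open Classical in if h : σ t ∈ M then ⟨σ t, h⟩ else p₀

theorem val_liftCurve (p₀ : KobayashiPoint M) {σ : ℝ → CSpace d} {t : ℝ} (h : σ t ∈ M) :
    (liftCurve p₀ σ t).val = σ t := by
  simp [liftCurve, h]

/-- A complete Gromov hyperbolic submanifold, as a metric space. -/
theorem kobayashi_proper_geodesic_hyperbolic (hsub : IsEmbeddedComplexSubmanifold M)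
    (hM : IsDiscChainConnected M) {C : ℝ} (hC0 : 0 < C) (hC : ∀ z ∈ M, ∀ w ∈ M, ‖z - w‖ ≤ C)
    (hcomplete : IsKobayashiComplete M) (hhyp : IsKobayashiGromovHyperbolic M) :
    letI := kobayashiMetricSpace hM hC0 hC
    ProperSpace (KobayashiPoint M) ∧
      (∀ x y : KobayashiPoint M, ∃ S, IsGeodesicSegment x y S) ∧
      ∃ δ, 0 ≤ δ ∧ HasThinTriangles (KobayashiPoint M) δ := by
  let := kobayashiMetricSpace hM hC0 hC
  have hdist : ∀ p q : KobayashiPoint M, dist p q = kobayashiDist M p.val q.val := fun _ _ => rfl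
  have : CompleteSpace (KobayashiPoint M) := by
    refine Metric.complete_of_cauchySeq_tendsto fun u hu => ?_
    obtain ⟨x, hx, hlim⟩ := hcomplete (fun n => (u n).val) (fun n => (u n).property)
      (fun ε hε => Metric.cauchySeq_iff.1 hu ε hε)
    exact ⟨⟨x, hx⟩, tendsto_iff_dist_tendsto_zero.2 hlim⟩
  have : LocallyCompactSpace M := hsub.isLocallyClosed.locallyCompactSpace
  have : LocallyCompactSpace (KobayashiPoint M) :=
    (kobayashiHomeomorph hsub hM hC0 hC).symm.isClosedEmbedding.locallyCompactSpace
  have happrox : HasApproximateGeodesics (KobayashiPoint M) := by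
    intro x y ε hε
    obtain ⟨c, hc, σ, hc0, h0, h1, hσM, hσk, -⟩ :=
      hM.exists_isUnitSpeedCurve x.property y.property hε
    refine ⟨liftCurve x σ, c, hc0, hc, KobayashiPoint.ext ?_, KobayashiPoint.ext ?_,
      fun s hs t ht => ?_⟩
    · rw [val_liftCurve x (hσM (left_mem_Icc.2 hc0)), h0]
    · rw [val_liftCurve x (hσM (right_mem_Icc.2 hc0)), h1]
    · rw [hdist, val_liftCurve x (hσM hs), val_liftCurve x (hσM ht)]
      exact hσk s hs t ht
  have : ProperSpace (KobayashiPoint M) := happrox.properSpace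
  refine ⟨this, happrox.exists_isGeodesicSegment, ?_⟩
  obtain ⟨δ, hδ⟩ := hhyp
  refine ⟨max δ 0, le_max_right _ _, ?_⟩
  rintro x y z _ _ _ ⟨γ₁, a₁, b₁, h₁, rfl, rfl, rfl⟩ ⟨γ₂, a₂, b₂, h₂, e₂, rfl, rfl⟩
    ⟨γ₃, a₃, b₃, h₃, e₃, e₁, rfl⟩ _ ⟨t, ht, rfl⟩
  have hval : ∀ {γ : ℝ → KobayashiPoint M} {a b : ℝ}, IsMetricGeodesic γ a b →
      IsKobayashiGeodesic M (fun t => (γ t).val) a b :=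
    fun h => ⟨h.1, fun t _ => (_ : KobayashiPoint M).property, h.2⟩
  rcases hδ _ _ _ a₁ b₁ a₂ b₂ a₃ b₃ (hval h₁) (hval h₂) (hval h₃) (congrArg KobayashiPoint.val e₂.symm)
    (congrArg KobayashiPoint.val e₃.symm) (congrArg KobayashiPoint.val e₁) t ht with
    ⟨s, hs, h⟩ | ⟨s, hs, h⟩
  · exact ⟨γ₂ s, Or.inl ⟨s, hs, rfl⟩, h.trans (le_max_left _ _)⟩
  · exact ⟨γ₃ s, Or.inr ⟨s, hs, rfl⟩, h.trans (le_max_left _ _)⟩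

end KobayashiSpace

theorem mainTheorem10 (d : ℕ) (M : Set (CSpace d)) (hsub : IsEmbeddedComplexSubmanifold M)
    (hconn : IsConnected M) (hbdd : Bornology.IsBounded M) (hcomplete : IsKobayashiComplete M)
    (hhyp : IsKobayashiGromovHyperbolic M) :
    IsBZVisibility M ↔ IsBNTVisibility M := by
  have hM := hsub.isDiscChainConnected hconn
  obtain ⟨C, hC0, hC⟩ : ∃ C : ℝ, 0 < C ∧ ∀ z ∈ M, ∀ w ∈ M, ‖z - w‖ ≤ C := by
    obtain ⟨C, hC⟩ := Metric.isBounded_iff.1 hbdd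
    exact ⟨max C 1, lt_max_of_lt_right one_pos, fun z hz w hw => by
      rw [← dist_eq_norm]
      exact (hC hz hw).trans (le_max_left _ _)⟩
  obtain ⟨hproper, hgeo, δ, hδ, hthin⟩ :=
    kobayashi_proper_geodesic_hyperbolic hsub hM hC0 hC hcomplete hhyp
  let := kobayashiMetricSpace hM hC0 hC
  have hdist : ∀ p q : KobayashiPoint M, dist p q = kobayashiDist M p.val q.val := fun _ _ => rfl
  obtain ⟨z₀, hz₀⟩ := hconn.nonempty
  set p₀ : KobayashiPoint M := ⟨z₀, hz₀⟩
  have hprop : ∀ (R : ℝ) (K : Set (CSpace d)), K ⊆ M → IsCompact K → ∃ K' ⊆ M, IsCompact K' ∧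
      ∀ x ∈ K, ∀ y ∈ M, kobayashiDist M x y ≤ R → y ∈ K' := by
    intro R K hKM hK
    have hK₁ : IsCompact (Subtype.val ⁻¹' K : Set M) := by
      rw [Subtype.isCompact_iff, Subtype.image_preimage_coe, inter_eq_self_of_subset_right hKM]
      exact hK
    have hK₂ := hK₁.image (kobayashiHomeomorph hsub hM hC0 hC).continuous
    obtain ⟨r, hr⟩ := hK₂.isBounded.subset_closedBall p₀
    refine ⟨KobayashiPoint.val '' Metric.closedBall p₀ (r + R), ?_, ?_, ?_⟩
    · rintro _ ⟨p, -, rfl⟩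
      exact p.property
    · exact (isCompact_closedBall p₀ (r + R)).image (continuous_subtype_val.comp
        (kobayashiHomeomorph hsub hM hC0 hC).symm.continuous)
    · intro x hx y hy hxy
      refine ⟨⟨y, hy⟩, ?_, rfl⟩
      have h1 : (⟨x, hKM hx⟩ : KobayashiPoint M) ∈ Metric.closedBall p₀ r :=
        hr ⟨⟨x, hKM hx⟩, hx, rfl⟩
      have h2 := dist_triangle_left (⟨y, hy⟩ : KobayashiPoint M) p₀ ⟨x, hKM hx⟩
      rw [Metric.mem_closedBall] at h1 ⊢
      rw [hdist ⟨x, _⟩ ⟨y, _⟩] at h2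
      linarith
  constructor
  · intro hBZ
    obtain ⟨hjoin, hvis⟩ := hBZ 1 1 le_rfl one_pos
    refine ⟨hcomplete, hvis.of_near hprop ⟨3 * δ + 3, fun γ a b hγ hne => ?_⟩⟩
    obtain ⟨hab, hγM, hγk⟩ := hγ
    obtain ⟨σ, a', b', hσ, hσa, hσb⟩ := hjoin _ (hγM (left_mem_Icc.2 hab)) _
      (hγM (right_mem_Icc.2 hab)) hne
    refine ⟨σ, a', b', hσ, hσa, hσb, fun t ht => ?_⟩
    obtain ⟨hab', hσM, hσk, -, -⟩ := hσ
    have hS : IsGeodesicSegment (liftCurve p₀ γ a) (liftCurve p₀ γ b)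
        (liftCurve p₀ γ '' Icc a b) := by
      refine ⟨liftCurve p₀ γ, a, b, ⟨hab, fun s hs t ht => ?_⟩, rfl, rfl, rfl⟩
      rw [hdist, val_liftCurve _ (hγM hs), val_liftCurve _ (hγM ht)]
      exact hγk s hs t ht
    have hla := left_mem_Icc.2 hab'
    have hlb := right_mem_Icc.2 hab'
    obtain ⟨_, ⟨s, hs, rfl⟩, h⟩ := hthin.near_geodesic_of_dist_add_dist_le hδ hgeo hS
      (x := ⟨σ t, hσM ht⟩) (c := 3) (by
        rw [hdist, hdist, hdist, val_liftCurve _ (hγM (left_mem_Icc.2 hab)),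
          val_liftCurve _ (hγM (right_mem_Icc.2 hab)), ← hσa, ← hσb]
        have h1 := (hσk t ht a' hla).2
        have h2 := (hσk b' hlb t ht).2
        have h3 := (hσk b' hlb a' hla).1
        rw [abs_of_nonpos (by linarith [ht.1])] at h1
        rw [abs_of_nonpos (by linarith [ht.2])] at h2
        rw [abs_of_nonpos (by linarith)] at h3
        linarith)
    rw [hdist, val_liftCurve _ (hγM hs)] at h
    exact ⟨s, hs, hγM hs, h⟩
  · rintro ⟨-, hvis⟩ lam kap hlam hkap
    refine ⟨fun x hx y hy _ => ?_, ?_⟩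
    · obtain ⟨c, hc, σ, hσ⟩ := hM.exists_isUnitSpeedCurve hx hy hkap
      exact ⟨σ, 0, c, hσ.isAlmostGeodesic hM hbdd hc hlam hkap.le, hσ.2.1, hσ.2.2.1⟩
    · obtain ⟨R, hR⟩ := hthin.geodesic_near_quasigeodesic hδ hgeo (lam := lam) (kap := kap)
        (by linarith) hkap.le
      refine hvis.of_near hprop ⟨R, fun σ a b hσ _ => ?_⟩
      obtain ⟨hab, hσM, hσk, -, -⟩ := hσ
      obtain ⟨S, hS⟩ := hgeo (liftCurve p₀ σ a) (liftCurve p₀ σ b)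
      have hnear := hR (liftCurve p₀ σ) a b hab (fun s hs t ht => by
        rw [hdist, val_liftCurve _ (hσM hs), val_liftCurve _ (hσM ht)]
        obtain ⟨h1, h2⟩ := hσk t ht s hs
        refine ⟨?_, h2⟩
        rw [sub_le_iff_le_add, one_div, inv_mul_le_iff₀ (by linarith)] at h1
        exact h1) S hS
      obtain ⟨γ, a', b', hγ, hγa, hγb, rfl⟩ := hS
      refine ⟨fun t => (γ t).val, a', b', ⟨hγ.1, fun t _ => (γ t).property, hγ.2⟩, ?_, ?_,
        fun t ht => ?_⟩
      · change (γ a').val = σ a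
        rw [hγa, val_liftCurve _ (hσM (left_mem_Icc.2 hab))]
      · change (γ b').val = σ b
        rw [hγb, val_liftCurve _ (hσM (right_mem_Icc.2 hab))]
      · obtain ⟨s, hs, h⟩ := hnear (γ t) ⟨t, ht, rfl⟩
        rw [hdist, val_liftCurve _ (hσM hs)] at h
        exact ⟨s, hs, hσM hs, h⟩
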